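/- A Peano continuum is a nonempty, connected, locally connected, compact metrizable space. Let $\mathbb{I}=[0,1]$, and in $\mathbb{R}^2$ let $A=(0,0)$, $B=(0,1)$, $A_n=(1/n,0)$, $B_n=(1/n,1)$ for $n\ge 1$, $L=[A,B]$, and $\mathcal{T}=L\cup\bigcup_{n\ge1}\bigl([A_n,B_n]\cup[B_n,A_{n+1}]\bigr)$, where $[P,Q]$ is the linear segment from $P$ to $Q$. For a compact space $X$ and $x\in X$, the Snake cone $SC(X,x)$ is the quotient space of the topological sum $(\mathcal{T}\times X)\sqcup \mathbb{I}^2$ obtained by identifying $(t,x)\in\mathcal{T}\times X$ with $t\in\mathbb{I}^2$ for every $t\in\mathcal{T}\setminus L$, and by identifying the whole set $\{t\}\times X$ with $t\in\mathbb{I}^2$ for every $t\in L$. For a space $X$ and $x\in X$, let $Y$ be the space obtained from copies $(X_n,x_n)$, $n\ge1$, of $(X,x)$ by joining $x_n$ to $x_{n+1}$ by an arc for every $n\ge 1$ and adding one new point each of whose neighbourhoods contains almost all of the $X_n$ and almost all of the arcs (an open set of $Y$ is a set whose intersections with all the $X_n$ and all the arcs are open in them and which, if it contains the new point, contains all but finitely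 many $X_n$ and arcs). The Alternating cone $AC(X,x)$ is the quotient space of $Y\times\mathbb{I}$ in which $X_n\times\{0\}$ is identified to a point for every odd $n$ and $X_n\times\{1\}$ is identified to a point for every even $n$. \textbf{Theorem.} Let $\mathbb{H}=\bigcup_{n\ge1}\{z\in\mathbb{C}: |z-1/n|=1/n\}$ be the Hawaiian earring. Then $\mathbb{H}$ is a Peano continuum, and for all base points $x,y\in\mathbb{H}$ the spaces $AC(\mathbb{H},x)$ and $SC(\mathbb{H},y)$ are not homotopy equivalent. Moreover, for every $x\in\mathbb{H}$ the natural map $\mathbb{H}\to SC(\mathbb{H},x)$, $h\mapsto[(A_1,h)]$, is an embedding that is not homotopic to a constant map, whereas every continuous map $\mathbb{H}\to AC(\mathbb{H},x)$ is homotopic to a constant map. -/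

import Mathlib

open Set

/-- A Peano continuum: a (nonempty) connected, locally connected, compact metrizable space. -/
structure IsPeanoContinuum (X : Type*) [TopologicalSpace X] : Prop where
  compact : CompactSpace X
  metrizable : TopologicalSpace.MetrizableSpace X
  connected : ConnectedSpace X
  locallyConnected : LocallyConnectedSpace X

/-- The Hawaiian earring: the union of the circles with centre `1/n` and radius `1/n`
in the plane, for `n = 1, 2, 3, …`, with the subspace topology. -/
def hawaiianEarring : Set ℂ :=
  ⋃ n : ℕ, Metric.sphere (((1 / ((n : ℝ) + 1) : ℝ) : ℂ)) (1 / ((n : ℝ) + 1))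

/-! ### The Snake cone -/

/-- The limit segment `L = [A, B]` with `A = (0, 0)` and `B = (0, 1)`. -/
def limitSegment : Set (ℝ × ℝ) := segment ℝ (0, 0) (0, 1)

/-- The piecewise linear topologist sine curve: the union of `L` and, for all `n ≥ 1`, of the
segments `[A_n, B_n]` and `[B_n, A_(n+1)]`, where `A_n = (1/n, 0)` and `B_n = (1/n, 1)`. -/
def sineCurve : Set (ℝ × ℝ) :=
  limitSegment ∪
    ⋃ n : ℕ,
      (segment ℝ (1 / ((n : ℝ) + 1), 0) (1 / ((n : ℝ) + 1), 1) ∪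
        segment ℝ (1 / ((n : ℝ) + 1), 1) (1 / ((n : ℝ) + 2), 0))

/-- The unit square in the plane. -/
def unitSquare : Set (ℝ × ℝ) := Icc 0 1 ×ˢ Icc 0 1

/-- The identifications of the Snake cone: `(t, x)` is identified with `t` in the square for
`t` in the sine curve off `L`, and all of `{t} × X` is identified with `t` for `t` in `L`. -/
inductive SnakeRel {X : Type*} (x : X) :
    (sineCurve × X) ⊕ unitSquare → (sineCurve × X) ⊕ unitSquare → Prop
  | base (t : sineCurve) (s : unitSquare) (hts : (t : ℝ × ℝ) = s)
      (ht : (t : ℝ × ℝ) ∉ limitSegment) : SnakeRel x (Sum.inl (t, x)) (Sum.inr s)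
  | limit (t : sineCurve) (y : X) (s : unitSquare) (hts : (t : ℝ × ℝ) = s)
      (ht : (t : ℝ × ℝ) ∈ limitSegment) : SnakeRel x (Sum.inl (t, y)) (Sum.inr s)

/-- The Snake cone `SC(X, x)`: the quotient of the topological sum of `T × X` and the unit square
by the equivalence relation generated by `SnakeRel`, with the quotient topology. -/
abbrev SnakeCone (X : Type*) [TopologicalSpace X] (x : X) : Type _ :=
  Quot (SnakeRel x)

/-- The point `A_1 = (1, 0)` of the sine curve. -/
def sineCurveStart : sineCurve :=
  ⟨(1, 0), Or.inr (mem_iUnion.2 ⟨0, Or.inl (by simpa using left_mem_segment ℝ _ _)⟩)⟩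

/-- The natural map `X → SC(X, x)`, `y ↦ [(A_1, y)]`. -/
def toSnakeCone {X : Type*} [TopologicalSpace X] (x : X) : C(X, SnakeCone X x) where
  toFun y := Quot.mk (SnakeRel x) (Sum.inl (sineCurveStart, y))
  continuous_toFun :=
    (continuous_quot_mk (r := SnakeRel x)).comp
      (continuous_inl.comp (continuous_const.prodMk continuous_id))

/-! ### The Alternating cone -/

/-- The space `Y`: copies `X_1, X_2, …` of `X`, an arc joining the base points `x_n` and `x_(n+1)`
for every `n ≥ 1`, and one more point, each of whose neighbourhoods contains almost all copies
and almost all arcs.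

It is realized as a subspace of `ℝ × (ℕ → X)`. The union of the arcs and the extra point is
`[0, 1] × {(x, x, …)}`: the extra point is at position `0`, the point `x_(n+1)` at position
`1/(n+1)`. The copy `X_(n+1)` consists of the points at position `1/(n+1)`: all coordinates in `X`
are `x`, except that coordinate `n` is arbitrary. The product topology induces on `[0, 1]` and on
each copy its own topology, and since points near position `0` have their coordinates of small
index equal to `x`, the extra point has the basic neighbourhoods `{position < ε}`. -/
def AlternatingBase (X : Type*) (x : X) : Set (ℝ × (ℕ → X)) :=
  {p | p.1 ∈ Icc (0 : ℝ) 1 ∧ ∀ n : ℕ, p.1 ≠ 1 / ((n : ℝ) + 1) → p.2 n = x}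

/-- The copy `X_(n+1)` of `X` in `Y`. -/
def copyOf {X : Type*} (x : X) (n : ℕ) : Set (AlternatingBase X x) :=
  {u | (u : ℝ × (ℕ → X)).1 = 1 / ((n : ℝ) + 1)}

/-- The identifications of the Alternating cone: at level `0` every copy `X_m` with `m` odd, and
at level `1` every copy `X_m` with `m` even, is identified to a point. -/
inductive AlternatingRel {X : Type*} (x : X) :
    AlternatingBase X x × unitInterval → AlternatingBase X x × unitInterval → Prop
  | bottom (n : ℕ) (hn : Odd (n + 1)) (u v : AlternatingBase X x)
      (hu : u ∈ copyOf x n) (hv : v ∈ copyOf x n) : AlternatingRel x (u, 0) (v, 0)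
  | top (n : ℕ) (hn : Even (n + 1)) (u v : AlternatingBase X x)
      (hu : u ∈ copyOf x n) (hv : v ∈ copyOf x n) : AlternatingRel x (u, 1) (v, 1)

/-- The Alternating cone `AC(X, x)`: the quotient of `Y × [0, 1]` by the equivalence relation
generated by `AlternatingRel`, with the quotient topology. -/
abbrev AlternatingCone (X : Type*) [TopologicalSpace X] (x : X) : Type _ :=
  Quot (AlternatingRel x)

/-! The two cones are told apart by maps out of the earring. If `AC(ℍ, x)` and `SC(ℍ, y)` were
homotopy equivalent, the natural map `ℍ → SC(ℍ, y)` would factor up to homotopy through `AC(ℍ, x)`;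
but every map from `ℍ` to `AC` is nullhomotopic and the natural map is not.

Alternating cone (`nullhomotopic_alternatingCone`). The heights below `3/4` and those above `1/4`
give two open sets whose inclusions are nullhomotopic: below `3/4`, slide everything down to height
`0`, where the odd copies are points, then lift to height `1`, where the even copies are points;
what remains lies on an arc (`nullhomotopic_of_flip`). The easy half of van Kampen makes `AC` simply
connected. Hence finitely many circles of a map from `ℍ` can be contracted, and the remaining small
ones already lie in one of the two open sets.

Snake cone (`not_nullhomotopic_toSnakeCone`). Off the limit segment the cone retracts to `ℍ`. In a
nullhomotopy of the natural map, as long as the trace of the origin has avoided the limit segment,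
all sufficiently small circles stay essential under this retraction. Off the sine curve the
retraction is constant, so the trace cannot leave the curve; but a path following the sine curve
cannot reach the limit segment (`sineCurve_oscillation`). So the trace avoids it up to time `1`,
when all circles are constant: a contradiction. -/

/-! ### Paths, simple connectedness and the circle -/

open Topology unitInterval in
/-- A nullhomotopic map identifies any two paths with the same endpoints. -/
theorem ContinuousMap.Nullhomotopic.map_path_homotopic {X Z : Type*} [TopologicalSpace X]
    [TopologicalSpace Z] {j : C(X, Z)} (hj : j.Nullhomotopic) {a b : X} (p q : Path a b) :
    (p.map j.continuous).Homotopic (q.map j.continuous) := by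
  obtain ⟨y, ⟨F⟩⟩ := hj
  -- Naturality of `F` along `r` gives `j(r) · F(b) = F(a)` in the path groupoid, so the class of
  -- `j(r)` does not depend on `r`.
  have key : ∀ r : Path a b, (Path.Homotopic.Quotient.mk (r.map j.continuous)).trans
      (Path.Homotopic.Quotient.mk (F.evalAt b)) = Path.Homotopic.Quotient.mk (F.evalAt a) := by
    intro r
    have h := Path.Homotopic.map_trans_evalAt F r
    have hr : r.map (map_continuous (ContinuousMap.const X y)) = Path.refl y := by
      ext t; rfl
    rw [hr] at h
    rw [← Path.Homotopic.Quotient.mk_trans]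
    rw [Path.Homotopic.Quotient.eq.2 h]
    exact Path.Homotopic.Quotient.trans_refl (Path.Homotopic.Quotient.mk (F.evalAt a))
  have h := (key p).trans (key q).symm
  have h2 := congrArg (fun e => e.trans (Path.Homotopic.Quotient.mk (F.evalAt b)).symm) h
  simp only [Path.Homotopic.Quotient.trans_assoc, Path.Homotopic.Quotient.trans_symm,
    Path.Homotopic.Quotient.trans_refl] at h2
  exact Path.Homotopic.Quotient.exact h2

open Topology unitInterval in
/-- A space covered by two path connected open sets with path connected intersection, whose
inclusions are nullhomotopic, is simply connected. -/
theorem simplyConnectedSpace_of_isOpen_cover {Z : Type*} [TopologicalSpace Z] (U : Bool → Set Z)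
    (hU : ∀ i, IsOpen (U i)) (hcov : ∀ z, ∃ i, z ∈ U i) (hc : ∀ i, IsPathConnected (U i))
    (hUV : IsPathConnected (⋂ i, U i))
    (hn : ∀ i, (⟨Subtype.val, continuous_subtype_val⟩ : C(U i, Z)).Nullhomotopic) :
    SimplyConnectedSpace Z := by
  obtain ⟨w, hw, hwj⟩ := hUV
  have hwi : ∀ i, w ∈ U i := fun i => mem_iInter.1 hw i
  have huniq : ∀ i {a b : Z} (p q : Path a b), (∀ t, p t ∈ U i) → (∀ t, q t ∈ U i) →
      Path.Homotopic.Quotient.mk p = Path.Homotopic.Quotient.mk q := by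
    intro i a b p q hp hq
    have ha : a ∈ U i := by simpa using hp 0
    have hb : b ∈ U i := by simpa using hp 1
    let p' : Path (⟨a, ha⟩ : U i) ⟨b, hb⟩ :=
      { toFun := fun t => ⟨p t, hp t⟩, source' := by simp, target' := by simp }
    let q' : Path (⟨a, ha⟩ : U i) ⟨b, hb⟩ :=
      { toFun := fun t => ⟨q t, hq t⟩, source' := by simp, target' := by simp }
    exact Path.Homotopic.Quotient.eq.2 ((hn i).map_path_homotopic p' q')
  have hjoin : ∀ i, ∀ z ∈ U i, ∃ p : Path w z, ∀ t, p t ∈ U i := by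
    intro i z hz
    obtain ⟨p, hp⟩ := (hc i).joinedIn w (hwi i) z hz
    exact ⟨p, hp⟩
  -- `e z` is the common class of all paths from `w` to `z` inside a single `U i`. If `z` is in both
  -- sets, a path in the intersection compares them; otherwise only one `i` is possible.
  have hex : ∀ z, ∃ e : Path.Homotopic.Quotient w z, ∀ i (p : Path w z), (∀ t, p t ∈ U i) →
      Path.Homotopic.Quotient.mk p = e := by
    intro z
    by_cases hz : z ∈ ⋂ i, U i
    · obtain ⟨p, hp⟩ := hwj hz
      exact ⟨.mk p, fun i q hq => huniq i q p hq fun t => mem_iInter.1 (hp t) i⟩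
    · obtain ⟨i, hi⟩ := hcov z
      obtain ⟨p, hp⟩ := hjoin i z hi
      refine ⟨.mk p, fun k q hq => ?_⟩
      obtain rfl : k = i := by
        by_contra hki
        refine hz (mem_iInter.2 fun l => ?_)
        have hk : z ∈ U k := by simpa using hq 1
        have hl : l = i ∨ l = k := by
          clear * - hki
          revert l k i; decide
        rcases hl with rfl | rfl
        · exact hi
        · exact hk
      exact huniq k q p hq hp
  choose e he using hex
  have hstep : ∀ i {a b : Z} (q : Path a b), (∀ t, q t ∈ U i) →
      (e a).trans (.mk q) = e b := by
    intro i a b q hq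
    have ha : a ∈ U i := by simpa using hq 0
    obtain ⟨p, hp⟩ := hjoin i a ha
    rw [← he a i p hp, ← Path.Homotopic.Quotient.mk_trans]
    refine he b i _ fun t => ?_
    have : p.trans q t ∈ range p ∪ range q := by
      rw [← Path.trans_range]; exact mem_range_self t
    rcases this with ⟨s, hs⟩ | ⟨s, hs⟩
    · rw [← hs]; exact hp s
    · rw [← hs]; exact hq s
  -- Lebesgue subdivision reduces to `hstep`; thus every path from `a` to `b` has class `(e a)⁻¹ · e
  -- b`.
  have hall : ∀ {a b : Z} (q : Path a b), (e a).trans (.mk q) = e b := by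
    intro a b q
    obtain ⟨t, h0, hmono, ⟨n, h1⟩, ht⟩ := exists_monotone_Icc_subset_open_cover_unitInterval
      (c := fun i => q ⁻¹' U i) (fun i => (hU i).preimage q.continuous) (fun s _ => by
        obtain ⟨i, hi⟩ := hcov (q s)
        exact mem_iUnion.2 ⟨i, hi⟩)
    have key : ∀ n, (e (q 0)).trans (.mk (q.subpath 0 (t n))) = e (q (t n)) := by
      intro n
      induction n with
      | zero => rw [h0]; simp
      | succ n ih =>
        obtain ⟨i, hi⟩ := ht n
        have h := hstep i (q.subpath (t n) (t (n + 1))) fun s => by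
          have : q.subpath (t n) (t (n + 1)) s ∈ q '' Icc (t n) (t (n + 1)) := by
            rw [← Path.range_subpath_of_le _ _ _ (hmono n.le_succ)]
            exact mem_range_self s
          obtain ⟨r, hr, hrs⟩ := this
          rw [← hrs]
          exact hi hr
        rw [← h, ← ih, Path.Homotopic.Quotient.trans_assoc,
          ← Path.Homotopic.Quotient.mk_trans]
        congr 1
        exact (Path.Homotopic.Quotient.eq.2
          ⟨Path.Homotopy.subpathTransSubpath q 0 (t n) (t (n + 1))⟩).symm
    have h := key n
    rw [h1 n le_rfl, Path.subpath_zero_one] at h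
    have hcast : ∀ {a' b' : Z} (ha : a' = a) (hb : b' = b),
        (e a').trans (.mk (q.cast ha hb)) = e b' → (e a).trans (.mk q) = e b := by
      rintro _ _ rfl rfl h
      exact h
    exact hcast _ _ h
  rw [simply_connected_iff_paths_homotopic']
  refine ⟨⟨⟨w⟩, fun a b => ?_⟩, fun {a b} p q => ?_⟩
  · have hj : ∀ z, Joined w z := fun z => by
      obtain ⟨i, hi⟩ := hcov z
      exact ((hc i).joinedIn w (hwi i) z hi).joined
    exact (hj a).symm.trans (hj b)
  · have h := (hall p).trans (hall q).symm
    have h2 := congrArg (fun r => (e a).symm.trans r) h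
    simp only [← Path.Homotopic.Quotient.trans_assoc, Path.Homotopic.Quotient.symm_trans,
      Path.Homotopic.Quotient.refl_trans] at h2
    exact Path.Homotopic.Quotient.exact h2

/-- Lifting a homotopy from a constant to the identity through `Circle.exp` yields a continuous
section `L (1, ·)`. The function `L (1, a) - L (1, -a)` is odd, so it vanishes somewhere on the
connected circle, and there `a = -a`. -/
theorem Circle.not_nullhomotopic_id : ¬ (ContinuousMap.id Circle).Nullhomotopic := by
  rintro ⟨y, h⟩
  obtain ⟨F⟩ := h.symm
  obtain ⟨θ, rfl⟩ : ∃ θ, Circle.exp θ = y := ⟨_, Circle.exp_arg y⟩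
  have hF0 : ∀ a, F.toContinuousMap (0, a) = Circle.exp (ContinuousMap.const Circle θ a) := by
    intro a; simp
  let L := Circle.isCoveringMap_exp.liftHomotopy F.toContinuousMap (.const Circle θ) hF0
  have hL : ∀ a : Circle, Circle.exp (L (1, a)) = a := by
    intro a
    have := congrFun (Circle.isCoveringMap_exp.liftHomotopy_lifts F.toContinuousMap _ hF0) (1, a)
    exact this.trans (F.apply_one a)
  have hconn : PreconnectedSpace Circle := by
    have : PreconnectedSpace (AddCircle (2 * Real.pi)) := inferInstance
    refine ⟨?_⟩
    rw [← AddCircle.homeomorphCircle'.surjective.range_eq]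
    exact isPreconnected_range AddCircle.homeomorphCircle'.continuous
  have hg : Continuous fun a : Circle => L (1, a) - L (1, Circle.exp Real.pi * a) := by fun_prop
  have hpp : Circle.exp Real.pi * Circle.exp Real.pi = 1 := by
    rw [← Circle.exp_add, ← two_mul]; exact Circle.exp_two_pi
  have hz : ∃ a, L (1, a) - L (1, Circle.exp Real.pi * a) = 0 := by
    rcases le_total (L (1, 1) - L (1, Circle.exp Real.pi * 1)) 0 with h | h
    · exact mem_range_of_exists_le_of_exists_ge hg ⟨1, h⟩
        ⟨Circle.exp Real.pi, by rw [hpp]; simp only [mul_one] at h; linarith⟩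
    · exact mem_range_of_exists_le_of_exists_ge hg
        ⟨Circle.exp Real.pi, by rw [hpp]; simp only [mul_one] at h; linarith⟩ ⟨1, h⟩
  obtain ⟨a, ha⟩ := hz
  have h1 : a = Circle.exp Real.pi * a := by
    rw [← hL (Circle.exp Real.pi * a), ← sub_eq_zero.1 ha, hL]
  have h2 : Circle.exp Real.pi = 1 := by simpa using h1
  have h3 := congrArg (fun z : Circle => (z : ℂ)) h2
  simp [Circle.coe_exp, Complex.exp_pi_mul_I] at h3
  norm_num at h3

open unitInterval in
/-- Loops in a simply connected space are contractible relative to the base point. -/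
theorem exists_contraction_of_simplyConnectedSpace {Z : Type*} [TopologicalSpace Z]
    [SimplyConnectedSpace Z] (g : C(Circle, Z)) :
    ∃ G : C(Circle, C(I, Z)), (∀ w, G w 0 = g w) ∧ (∀ w, G w 1 = g 1) ∧ ∀ t, G 1 t = g 1 := by
  let e : C(I, Circle) := ⟨fun s => Circle.exp (2 * Real.pi * s), by fun_prop⟩
  have he0 : e 0 = 1 := by simp [e]
  have he1 : e 1 = 1 := by simp [e]
  have hinj : ∀ s s' : I, e s = e s' → s = s' ∨ (e s = 1 ∧ e s' = 1 ∧ (s = 0 ∨ s = 1) ∧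
      (s' = 0 ∨ s' = 1)) := by
    intro s s' h
    obtain ⟨m, hm⟩ := Circle.exp_eq_exp.1 h
    have hpi : (2 * Real.pi) ≠ 0 := by positivity
    have hm' : (s : ℝ) = s' + m := by
      have : 2 * Real.pi * (s : ℝ) = 2 * Real.pi * (s' + m) := by rw [hm]; ring
      exact mul_left_cancel₀ hpi this
    have h1 := s.2.1
    have h2 := s.2.2
    have h3 := s'.2.1
    have h4 := s'.2.2
    have hmle : (m : ℝ) ≤ 1 := by linarith
    have hmge : (-1 : ℝ) ≤ m := by linarith
    have : m ≤ 1 := by exact_mod_cast hmle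
    have : -1 ≤ m := by exact_mod_cast hmge
    obtain rfl | rfl | rfl : m = -1 ∨ m = 0 ∨ m = 1 := by omega
    · have hs : s = 0 := Subtype.ext (by push_cast at hm'; push_cast; linarith)
      have hs' : s' = 1 := Subtype.ext (by push_cast at hm'; push_cast; linarith)
      subst hs hs'
      exact Or.inr ⟨he0, he1, Or.inl rfl, Or.inr rfl⟩
    · left; exact Subtype.ext (by simpa using hm')
    · have hs : s = 1 := Subtype.ext (by push_cast at hm'; push_cast; linarith)
      have hs' : s' = 0 := Subtype.ext (by push_cast at hm'; push_cast; linarith)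
      subst hs hs'
      exact Or.inr ⟨he1, he0, Or.inr rfl, Or.inl rfl⟩
  have hsurj : Function.Surjective e := by
    intro w
    obtain ⟨θ, hθ⟩ : ∃ θ, Circle.exp θ = w := ⟨_, Circle.exp_arg w⟩
    refine ⟨⟨Int.fract (θ / (2 * Real.pi)), Int.fract_nonneg _, (Int.fract_lt_one _).le⟩, ?_⟩
    rw [← hθ]
    refine Circle.exp_eq_exp.2 ⟨-⌊θ / (2 * Real.pi)⌋, ?_⟩
    have hpi : Real.pi ≠ 0 := Real.pi_ne_zero
    simp only [Int.fract]
    push_cast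
    field_simp
    ring
  have hq : Topology.IsQuotientMap e :=
    e.continuous.isClosedMap.isQuotientMap e.continuous hsurj
  let p : Path (g 1) (g 1) :=
    { toContinuousMap := g.comp e, source' := by simp [he0], target' := by simp [he1] }
  obtain ⟨F⟩ := SimplyConnectedSpace.paths_homotopic p (Path.refl _)
  -- In curried form the homotopy descends along the quotient map `e : I → Circle`, which identifies
  -- only the endpoints; there `K` is constantly `g 1`.
  let K : C(I, C(I, Z)) := (F.toContinuousMap.comp ContinuousMap.prodSwap).curry
  have hK : ∀ s t, K s t = F (t, s) := fun _ _ => rfl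
  have hKe : ∀ s, (s = 0 ∨ s = 1) → ∀ t, K s t = g 1 := by
    rintro s (rfl | rfl) t <;> simp [hK]
  have hfac : Function.FactorsThrough K e := by
    intro s s' h
    rcases hinj s s' h with rfl | ⟨-, -, h1, h2⟩
    · rfl
    · ext t; rw [hKe s h1, hKe s' h2]
  let G : C(Circle, C(I, Z)) := hq.lift K hfac
  have hG : ∀ s, G (e s) = K s := fun s => by
    exact DFunLike.congr_fun (hq.lift_comp K hfac) s
  refine ⟨G, fun w => ?_, fun w => ?_, fun t => ?_⟩
  · obtain ⟨s, rfl⟩ := hsurj w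
    rw [hG, hK]
    simp [p]
  · obtain ⟨s, rfl⟩ := hsurj w
    rw [hG, hK]
    simp
  · rw [← he0, hG, hKe 0 (Or.inl rfl), he0]

/-! ### The Alternating cone is simply connected -/

namespace AlternatingCone

open Topology unitInterval

variable {X : Type*} [TopologicalSpace X] {x : X}

/-- The class of `(u, s)` in the Alternating cone. -/
def mk (p : AlternatingBase X x × I) : AlternatingCone X x := Quot.mk _ p

theorem continuous_mk : Continuous (mk : AlternatingBase X x × I → AlternatingCone X x) :=
  continuous_quot_mk

theorem mk_bottom {n : ℕ} (hn : Odd (n + 1)) {u v : AlternatingBase X x}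
    (hu : u ∈ copyOf x n) (hv : v ∈ copyOf x n) : mk (u, 0) = mk (v, 0) :=
  Quot.sound (.bottom n hn u v hu hv)

theorem mk_top {n : ℕ} (hn : ¬ Odd (n + 1)) {u v : AlternatingBase X x}
    (hu : u ∈ copyOf x n) (hv : v ∈ copyOf x n) : mk (u, 1) = mk (v, 1) :=
  Quot.sound (.top n (Nat.not_odd_iff_even.1 hn) u v hu hv)

/-- The arc of base points of the copies, together with the limit point. -/
def line (x : X) : C(I, AlternatingBase X x) where
  toFun a := ⟨(a, fun _ => x), a.2, fun _ _ => rfl⟩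
  continuous_toFun := by fun_prop

/-- The position in `[0, 1]` of a point of the base. -/
def position (x : X) : C(AlternatingBase X x, I) where
  toFun u := ⟨u.1.1, u.2.1⟩
  continuous_toFun := by fun_prop

open Classical in
/-- The retraction of the base that collapses the copies with index in `S` to their base points. -/
noncomputable def collapse (x : X) (S : Set ℕ) : C(AlternatingBase X x, AlternatingBase X x) where
  toFun u := ⟨(u.1.1, fun n => if n ∈ S then x else u.1.2 n), u.2.1, fun n hn => by
    simp only
    split_ifs with h
    · rfl
    · exact u.2.2 n hn⟩
  continuous_toFun := by
    refine Continuous.subtype_mk (Continuous.prodMk (by fun_prop) (continuous_pi fun n => ?_)) _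
    by_cases h : n ∈ S
    · simpa [h] using continuous_const
    · simp only [h, if_false]
      fun_prop

theorem collapse_mem_copyOf {S : Set ℕ} {n : ℕ} {u : AlternatingBase X x}
    (hu : u ∈ copyOf x n) : collapse x S u ∈ copyOf x n := hu

theorem line_mem_copyOf {n : ℕ} {u : AlternatingBase X x}
    (hu : u ∈ copyOf x n) : line x (position x u) ∈ copyOf x n := hu

theorem eq_of_mem_copyOf {X : Type*} {x : X} {m n : ℕ} {u : AlternatingBase X x} (hm : u ∈ copyOf x m)
    (hn : u ∈ copyOf x n) : m = n := by
  have h : 1 / ((m : ℝ) + 1) = 1 / ((n : ℝ) + 1) := hm.symm.trans hn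
  rw [one_div, one_div, inv_inj] at h
  exact_mod_cast add_right_cancel h

theorem eq_base_of_mem_copyOf {X : Type*} {x : X} {m n : ℕ} {u : AlternatingBase X x} (hm : u ∈ copyOf x m)
    (hn : n ≠ m) : u.1.2 n = x :=
  u.2.2 n fun h => hn (eq_of_mem_copyOf (show u ∈ copyOf x n from h) hm)

theorem collapse_eq_line {S : Set ℕ} {n : ℕ} (hn : n ∈ S) {u : AlternatingBase X x}
    (hu : u ∈ copyOf x n) : collapse x S u = line x (position x u) := by
  refine Subtype.ext (Prod.ext rfl (funext fun k => ?_))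
  simp only [collapse, line, ContinuousMap.coe_mk]
  split_ifs with hk
  · rfl
  · exact eq_base_of_mem_copyOf hu fun h => hk (h ▸ hn)

theorem exists_copyOf_of_collapse_ne {S : Set ℕ} {u : AlternatingBase X x}
    (h : collapse x S u ≠ u) : ∃ n ∈ S, u ∈ copyOf x n := by
  by_contra! hc
  refine h (Subtype.ext (Prod.ext rfl (funext fun k => ?_)))
  simp only [collapse, ContinuousMap.coe_mk]
  split_ifs with hk
  · exact (u.2.2 k (hc k hk)).symm
  · rfl

theorem exists_copyOf_of_collapse_ne_line {S : Set ℕ} {u : AlternatingBase X x}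
    (h : collapse x S u ≠ line x (position x u)) : ∃ n ∉ S, u ∈ copyOf x n := by
  by_contra! hc
  refine h (Subtype.ext (Prod.ext rfl (funext fun k => ?_)))
  simp only [collapse, line, ContinuousMap.coe_mk]
  split_ifs with hk
  · rfl
  · exact u.2.2 k (hc k hk)

/-- The height of a point of the Alternating cone. -/
def height (x : X) : C(AlternatingCone X x, I) where
  toFun := Quot.lift Prod.snd (by rintro _ _ (_ | _) <;> rfl)
  continuous_toFun := continuous_quot_lift _ continuous_snd

/-- The position of a point of the Alternating cone. -/
def conePosition (x : X) : C(AlternatingCone X x, I) where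
  toFun := Quot.lift (fun p => position x p.1) (by
    rintro _ _ (⟨n, -, u, v, hu, hv⟩ | ⟨n, -, u, v, hu, hv⟩) <;>
    exact Subtype.ext (hu.trans hv.symm))
  continuous_toFun := continuous_quot_lift _ (by fun_prop)

/-- A homotopy of `Y × [0, 1]` that acts separately on the factors descends to the cone if it
respects the identifications. -/
theorem exists_slide (r : C(AlternatingBase X x, AlternatingBase X x)) (φ : C(I × I, I))
    (h : ∀ t a b, AlternatingRel x a b → mk (r a.1, φ (t, a.2)) = mk (r b.1, φ (t, b.2))) :
    ∃ Φ : C(I × AlternatingCone X x, AlternatingCone X x),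
      ∀ t u s, Φ (t, mk (u, s)) = mk (r u, φ (t, s)) := by
  -- Currying the time variable lets the homotopy descend by the universal property of the quotient
  -- alone.
  let K : C(AlternatingBase X x × I, C(I, AlternatingCone X x)) :=
    ContinuousMap.curry
      ⟨fun p => mk (r p.1.1, φ (p.2, p.1.2)), continuous_mk.comp (by fun_prop)⟩
  let L : C(AlternatingCone X x, C(I, AlternatingCone X x)) :=
    ⟨Quot.lift K fun a b hab => by ext t; exact h t a b hab, continuous_quot_lift _ K.continuous⟩
  exact ⟨L.uncurry.comp ContinuousMap.prodSwap, fun t u s => rfl⟩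

/-- Treats both ends of the cone at once: `κ` is to be the identity or the flip of `I`, and `S` the
set of copies pinched at height `κ 0`; the others are pinched at `κ 1`. Heights in the steps below
are read through `κ`. -/
theorem nullhomotopic_of_flip {S : Set ℕ} {κ : C(I, I)} (hκ : ∀ s, κ (κ s) = s)
    (hrel : ∀ a b, AlternatingRel x a b → ∃ n, a.1 ∈ copyOf x n ∧ b.1 ∈ copyOf x n ∧
      ((n ∈ S ∧ a.2 = κ 0 ∧ b.2 = κ 0) ∨ (n ∉ S ∧ a.2 = κ 1 ∧ b.2 = κ 1)))
    (hbot : ∀ n ∈ S, ∀ u ∈ copyOf x n, ∀ v ∈ copyOf x n, mk (u, κ 0) = mk (v, κ 0))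
    (htop : ∀ n ∉ S, ∀ u ∈ copyOf x n, ∀ v ∈ copyOf x n, mk (u, κ 1) = mk (v, κ 1))
    {Z : Type*} [TopologicalSpace Z] (f : C(Z, AlternatingCone X x))
    (hf : ∀ z, (κ (height x (f z)) : ℝ) ≤ 3 / 4) : f.Nullhomotopic := by
  let clamp : C(ℝ, I) := ⟨projIcc 0 1 zero_le_one, continuous_projIcc⟩
  have clamp0 : ∀ a, a ≤ 0 → clamp a = 0 := fun a ha => projIcc_of_le_left zero_le_one ha
  have clamp1 : ∀ a, 1 ≤ a → clamp a = 1 := fun a ha => projIcc_of_right_le zero_le_one ha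
  have clampI : ∀ a : I, clamp a = a := fun a => projIcc_val zero_le_one a
  -- `Φ` moves height `s` to `s - 3t(1 - s)`, clamped: both ends stay fixed, and at `t = 1` the
  -- value `4s - 3` is clamped to `0` for `s ≤ 3/4`.
  obtain ⟨Φ, hΦ⟩ := exists_slide (x := x) (.id _)
    ⟨fun p => κ (clamp (κ p.2 - 3 * p.1 * (1 - κ p.2))), by fun_prop⟩ (by
      rintro t ⟨u, s⟩ ⟨v, s'⟩ hab
      obtain ⟨n, hu, hv, ⟨hn, rfl, rfl⟩ | ⟨hn, rfl, rfl⟩⟩ := hrel _ _ hab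
      · have h0 : clamp (((κ (κ 0) : I) : ℝ) - 3 * t * (1 - (κ (κ 0) : I))) = 0 := by
          rw [hκ]
          exact clamp0 _ (by have := t.2.1; simp [this])
        simpa [h0] using hbot n hn u hu v hv
      · have h1 : clamp (((κ (κ 1) : I) : ℝ) - 3 * t * (1 - (κ (κ 1) : I))) = 1 := by
          rw [hκ]
          exact clamp1 _ (by simp)
        simpa [h1] using htop n hn u hu v hv)
  -- `Ψ` lifts everything to height `1`. Collapsing the copies in `S` makes this compatible with
  -- their pinching at height `0`, and is invisible at the start, when the image of `f` is already
  -- at height `0`.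
  obtain ⟨Ψ, hΨ⟩ := exists_slide (x := x) (collapse x S)
    ⟨fun p => κ (clamp (max (4 * κ p.2 - 3) p.1)), by fun_prop⟩ (by
      rintro t ⟨u, s⟩ ⟨v, s'⟩ hab
      obtain ⟨n, hu, hv, ⟨hn, rfl, rfl⟩ | ⟨hn, rfl, rfl⟩⟩ := hrel _ _ hab
      · have : collapse x S u = collapse x S v := by
          rw [collapse_eq_line hn hu, collapse_eq_line hn hv]
          congr 1
          exact Subtype.ext (hu.trans hv.symm)
        simp [this]
      · have h1 : clamp (max (4 * ((κ (κ 1) : I) : ℝ) - 3) t) = 1 := by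
          rw [hκ]
          exact clamp1 _ (by norm_num)
        simpa [h1] using htop n hn _ (collapse_mem_copyOf hu) _ (collapse_mem_copyOf hv))
  simp only [ContinuousMap.coe_mk, ContinuousMap.id_apply] at hΦ hΨ
  let g : C(Z, AlternatingCone X x) :=
    Ψ.comp ((ContinuousMap.const Z (0 : I)).prodMk f)
  have hfg : f.Homotopic g := by
    refine ⟨⟨Φ.comp ((ContinuousMap.id I).prodMap f), fun z => ?_, fun z => ?_⟩⟩
    · obtain ⟨⟨u, s⟩, hus⟩ := Quot.exists_rep (f z)
      change Φ (0, f z) = f z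
      rw [← hus]
      refine (hΦ 0 u s).trans ?_
      simp [clampI, hκ]
      rfl
    · have hz := hf z
      obtain ⟨⟨u, s⟩, hus⟩ := Quot.exists_rep (f z)
      change Φ (1, f z) = Ψ (0, f z)
      rw [← hus] at hz ⊢
      replace hz : (κ s : ℝ) ≤ 3 / 4 := hz
      refine (hΦ 1 u s).trans (.trans ?_ (hΨ 0 u s).symm)
      have h0 : clamp ((κ s : ℝ) - 3 * (1 : I) * (1 - κ s)) = 0 :=
        clamp0 _ (by simp; linarith)
      have h0' : clamp (max (4 * (κ s : ℝ) - 3) (0 : I)) = 0 :=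
        clamp0 _ (by simp; linarith)
      rw [h0, h0']
      by_cases hu : collapse x S u = u
      · rw [hu]
      · obtain ⟨n, hn, hun⟩ := exists_copyOf_of_collapse_ne hu
        exact hbot n hn _ hun _ (collapse_mem_copyOf hun)
  let l : C(I, AlternatingCone X x) := ⟨fun a => mk (line x a, κ 1), continuous_mk.comp (by fun_prop)⟩
  have hgl : g.Homotopic (l.comp ((conePosition x).comp f)) := by
    refine ⟨⟨Ψ.comp ((ContinuousMap.id I).prodMap f), fun z => rfl, fun z => ?_⟩⟩
    obtain ⟨⟨u, s⟩, hus⟩ := Quot.exists_rep (f z)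
    change Ψ (1, f z) = l (conePosition x (f z))
    rw [← hus]
    refine (hΨ 1 u s).trans ?_
    rw [clamp1 _ (le_max_of_le_right (by simp))]
    change mk (collapse x S u, κ 1) = mk (line x (position x u), κ 1)
    by_cases hu : collapse x S u = line x (position x u)
    · rw [hu]
    · obtain ⟨n, hn, hun⟩ := exists_copyOf_of_collapse_ne_line hu
      exact htop n hn _ (collapse_mem_copyOf hun) _ (line_mem_copyOf hun)
  have hI : ContractibleSpace I := (convex_Icc (0 : ℝ) 1).contractibleSpace ⟨0, by simp⟩
  have hl : (l.comp ((conePosition x).comp f)).Nullhomotopic :=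
    ((id_nullhomotopic I).comp_left ((conePosition x).comp f)).comp_right l
  obtain ⟨y, hy⟩ := hl
  exact ⟨y, (hfg.trans hgl).trans hy⟩

theorem nullhomotopic_of_height_le {Z : Type*} [TopologicalSpace Z]
    (f : C(Z, AlternatingCone X x)) (hf : ∀ z, (height x (f z) : ℝ) ≤ 3 / 4) :
    f.Nullhomotopic := by
  refine nullhomotopic_of_flip (S := {n | Odd (n + 1)}) (κ := .id I) (fun _ => rfl) ?_
    (fun n hn u hu v hv => mk_bottom hn hu hv) (fun n hn u hu v hv => mk_top hn hu hv) f hf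
  rintro _ _ (⟨n, hn, u, v, hu, hv⟩ | ⟨n, hn, u, v, hu, hv⟩)
  · exact ⟨n, hu, hv, Or.inl ⟨hn, rfl, rfl⟩⟩
  · exact ⟨n, hu, hv, Or.inr ⟨Nat.not_odd_iff_even.2 hn, rfl, rfl⟩⟩

theorem nullhomotopic_of_le_height {Z : Type*} [TopologicalSpace Z]
    (f : C(Z, AlternatingCone X x)) (hf : ∀ z, 1 / 4 ≤ (height x (f z) : ℝ)) :
    f.Nullhomotopic := by
  refine nullhomotopic_of_flip (S := {n | ¬ Odd (n + 1)}) (κ := ⟨σ, continuous_symm⟩)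
    (fun s => symm_symm s) ?_
    (fun n hn u hu v hv => by simpa using mk_top hn hu hv)
    (fun n hn u hu v hv => by simpa using mk_bottom (not_not.1 hn) hu hv) f
    (fun z => by have := hf z; simp only [ContinuousMap.coe_mk, coe_symm_eq]; linarith)
  rintro _ _ (⟨n, hn, u, v, hu, hv⟩ | ⟨n, hn, u, v, hu, hv⟩)
  · exact ⟨n, hu, hv, Or.inr ⟨not_not.2 hn, by simp, by simp⟩⟩
  · exact ⟨n, hu, hv, Or.inl ⟨Nat.not_odd_iff_even.2 hn, by simp, by simp⟩⟩

theorem pathConnectedSpace_base [PathConnectedSpace X] :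
    PathConnectedSpace (AlternatingBase X x) := by
  have hI : PathConnectedSpace I := isPathConnected_iff_pathConnectedSpace.1
    ((convex_Icc (0 : ℝ) 1).isPathConnected ⟨0, by simp⟩)
  have hj : ∀ u : AlternatingBase X x, Joined u (line x 0) := by
    intro u
    have h1 : Joined u (line x (position x u)) := by
      by_cases hu : ∃ n, u ∈ copyOf x n
      · obtain ⟨n, hn⟩ := hu
        obtain ⟨p⟩ := PathConnectedSpace.joined (u.1.2 n) x
        refine ⟨⟨⟨fun t => ⟨(u.1.1, Function.update u.1.2 n (p t)), u.2.1, fun k hk => ?_⟩,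
          ?_⟩, ?_, ?_⟩⟩
        · have hkn : k ≠ n := by rintro rfl; exact hk hn
          simpa [hkn] using u.2.2 k hk
        · refine Continuous.subtype_mk (continuous_const.prodMk ?_) _
          exact continuous_const.update n p.continuous
        · exact Subtype.ext (Prod.ext rfl (by simp))
        · refine Subtype.ext (Prod.ext rfl (funext fun k => ?_))
          by_cases hk : k = n
          · subst hk; simp [line]
          · simpa [hk, line] using eq_base_of_mem_copyOf hn hk
      · push Not at hu
        have : u = line x (position x u) :=
          Subtype.ext (Prod.ext rfl (funext fun k => u.2.2 k (hu k)))
        exact this ▸ Joined.refl _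
    exact h1.trans ((PathConnectedSpace.joined (position x u) 0).map (line x).continuous)
  exact ⟨⟨line x 0⟩, fun u v => (hj u).trans (hj v).symm⟩

theorem isPathConnected_height_preimage [PathConnectedSpace X] {J : Set I} (hJ : IsPathConnected J) :
    IsPathConnected (height x ⁻¹' J) := by
  have hY := pathConnectedSpace_base (x := x)
  have : height x ⁻¹' J = mk '' (univ ×ˢ J) := by
    ext z
    obtain ⟨p, rfl⟩ := Quot.exists_rep z
    constructor
    · intro h
      exact ⟨p, ⟨trivial, h⟩, rfl⟩
    · rintro ⟨q, ⟨-, hq⟩, hqp⟩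
      have : height x (mk q) ∈ J := hq
      rw [hqp] at this
      exact this
  rw [this]
  exact ((pathConnectedSpace_iff_univ.1 hY).prod hJ).image continuous_mk

theorem isPathConnected_Ioo_preimage {a b : ℝ} (ha : a < 1 / 2) (hb : 1 / 2 < b) :
    IsPathConnected {s : I | a < s ∧ (s : ℝ) < b} := by
  rw [Topology.IsInducing.subtypeVal.isPathConnected_iff]
  have : (Subtype.val '' {s : I | a < s ∧ (s : ℝ) < b}) = Icc 0 1 ∩ Ioo a b := by
    ext s
    simp only [mem_image, mem_ofPred_eq, Subtype.exists, exists_and_right, exists_eq_right,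
      mem_inter_iff, mem_Ioo]
    exact ⟨fun ⟨⟨h, h'⟩, h''⟩ => ⟨h, h', h''⟩, fun ⟨h, h', h''⟩ => ⟨⟨h, h'⟩, h''⟩⟩
  rw [this]
  exact ((convex_Icc _ _).inter (convex_Ioo _ _)).isPathConnected
    ⟨1 / 2, ⟨by norm_num, by norm_num⟩, ha, hb⟩

theorem simplyConnectedSpace [PathConnectedSpace X] : SimplyConnectedSpace (AlternatingCone X x) := by
  -- The bounds `-1` and `2` are vacuous for heights in `[0, 1]`; they give both sets the same form.
  have hU : ∀ i : Bool, ({z | (if i then 1 / 4 else -1 : ℝ) < height x z ∧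
      (height x z : ℝ) < (if i then 2 else 3 / 4)} : Set (AlternatingCone X x)) =
      height x ⁻¹' {s : I | (if i then 1 / 4 else -1 : ℝ) < s ∧
        (s : ℝ) < (if i then 2 else 3 / 4)} := fun _ => rfl
  refine simplyConnectedSpace_of_isOpen_cover
    (fun i : Bool => {z | (if i then 1 / 4 else -1 : ℝ) < height x z ∧
      (height x z : ℝ) < (if i then 2 else 3 / 4)}) (fun i => ?_) (fun z => ?_) (fun i => ?_) ?_
      (fun i => ?_)
  · simp only [hU]
    refine IsOpen.preimage (height x).continuous ?_
    exact (isOpen_lt continuous_const continuous_subtype_val).inter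
      (isOpen_lt continuous_subtype_val continuous_const)
  · by_cases h : (height x z : ℝ) < 3 / 4
    · exact ⟨false, by simp only [Bool.false_eq_true, if_false, mem_ofPred_eq]
                       exact ⟨by linarith [(height x z).2.1], h⟩⟩
    · exact ⟨true, by simp only [if_true, mem_ofPred_eq]
                      exact ⟨by linarith, by linarith [(height x z).2.2]⟩⟩
  · simp only [hU]
    refine isPathConnected_height_preimage (isPathConnected_Ioo_preimage ?_ ?_) <;>
    cases i <;> norm_num
  · have : (⋂ i : Bool, {z | (if i then 1 / 4 else -1 : ℝ) < height x z ∧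
        (height x z : ℝ) < (if i then 2 else 3 / 4)}) =
        height x ⁻¹' {s : I | (1 / 4 : ℝ) < s ∧ (s : ℝ) < 3 / 4} := by
      ext z
      simp only [mem_iInter, Bool.forall_bool, mem_ofPred_eq, mem_preimage, Bool.false_eq_true,
        if_false, if_true]
      have h0 := (height x z).2.1
      have h1 := (height x z).2.2
      constructor
      · rintro ⟨⟨-, h⟩, h', -⟩; exact ⟨h', h⟩
      · rintro ⟨h', h⟩; exact ⟨⟨by linarith, h⟩, h', by linarith⟩
    rw [this]
    exact isPathConnected_height_preimage (isPathConnected_Ioo_preimage (by norm_num) (by norm_num))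
  · cases i
    · exact nullhomotopic_of_height_le _ fun z => by
        have := z.2.2
        simp only [Bool.false_eq_true, if_false] at this
        exact this.le
    · exact nullhomotopic_of_le_height _ fun z => by
        have := z.2.1
        simp only [if_true] at this
        exact this.le

end AlternatingCone

/-! ### The circles of the earring and the maps wrapping them -/

namespace HawaiianEarring

open Topology unitInterval Filter

/-- For `z ≠ 0` the equation says `2 * re (1/z) = n + 1`: inversion turns the circles into parallel
lines at integer values, which `bump` separates. -/
theorem mem_sphere_iff (n : ℕ) (z : ℂ) :
    z ∈ Metric.sphere (((1 / ((n : ℝ) + 1) : ℝ) : ℂ)) (1 / ((n : ℝ) + 1)) ↔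
      Complex.normSq z * (n + 1) = 2 * z.re := by
  have hn : (0 : ℝ) < n + 1 := by positivity
  rw [mem_sphere_iff_norm, ← sq_eq_sq₀ (norm_nonneg _) (by positivity), ← Complex.normSq_eq_norm_sq,
    Complex.normSq_apply, Complex.normSq_apply]
  simp only [Complex.sub_re, Complex.sub_im, Complex.ofReal_re, Complex.ofReal_im]
  field_simp
  constructor <;> intro h <;> nlinarith

theorem mem_iff (z : ℂ) :
    z ∈ hawaiianEarring ↔ ∃ n : ℕ, Complex.normSq z * (n + 1) = 2 * z.re := by
  simp only [hawaiianEarring, mem_iUnion, mem_sphere_iff]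

/-- The point common to all circles. -/
def origin : hawaiianEarring := ⟨0, (mem_iff 0).2 ⟨0, by simp⟩⟩

theorem loop_mem (n : ℕ) (w : Circle) :
    Complex.normSq ((1 - w : ℂ) / (n + 1)) * (n + 1) = 2 * ((1 - w : ℂ) / (n + 1)).re := by
  have hn : (n : ℝ) + 1 ≠ 0 := by positivity
  have hw : (w : ℂ).re * (w : ℂ).re + (w : ℂ).im * (w : ℂ).im = 1 := by
    rw [← Complex.normSq_apply]; exact Circle.normSq_coe w
  have h1 : ((1 - w : ℂ) / (n + 1)).re = (1 - (w : ℂ).re) / (n + 1) := by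
    rw [show ((n : ℂ) + 1) = ((n + 1 : ℝ) : ℂ) by push_cast; rfl, Complex.div_ofReal_re]
    simp
  have h2 : ((1 - w : ℂ) / (n + 1)).im = - (w : ℂ).im / (n + 1) := by
    rw [show ((n : ℂ) + 1) = ((n + 1 : ℝ) : ℂ) by push_cast; rfl, Complex.div_ofReal_im]
    simp
  rw [Complex.normSq_apply, h1, h2]
  field_simp
  linarith

/-- The parametrization of the circle of radius `1 / (n + 1)` that starts at the origin. -/
noncomputable def loop (n : ℕ) : C(Circle, hawaiianEarring) where
  toFun w := ⟨(1 - w) / (n + 1), (mem_iff _).2 ⟨n, loop_mem n w⟩⟩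
  continuous_toFun := by fun_prop

theorem coe_loop (n : ℕ) (w : Circle) : (loop n w : ℂ) = (1 - w) / (n + 1) := rfl

@[simp]
theorem loop_one (n : ℕ) : loop n 1 = origin := Subtype.ext (by simp [coe_loop, origin])

theorem exists_loop_eq (z : hawaiianEarring) : ∃ n w, loop n w = z := by
  obtain ⟨n, hn⟩ := (mem_iff _).1 z.2
  have hn0 : (n : ℂ) + 1 ≠ 0 := by exact_mod_cast n.succ_ne_zero
  have h1 : ‖1 - ((n : ℂ) + 1) * z‖ = 1 := by
    rw [← sq_eq_sq₀ (norm_nonneg _) zero_le_one, ← Complex.normSq_eq_norm_sq]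
    rw [Complex.normSq_apply] at hn ⊢
    simp
    nlinarith
  let w : Circle := ⟨1 - ((n : ℂ) + 1) * z, mem_sphere_zero_iff_norm.2 h1⟩
  refine ⟨n, w, Subtype.ext ?_⟩
  rw [coe_loop]
  change (1 - (1 - ((n : ℂ) + 1) * z)) / (n + 1) = (z : ℂ)
  field_simp
  simp

theorem norm_loop_le (n : ℕ) (w : Circle) : ‖(loop n w : ℂ)‖ ≤ 2 / (n + 1) := by
  rw [coe_loop, norm_div]
  have h1 : ‖(1 - w : ℂ)‖ ≤ 2 := (norm_sub_le _ _).trans (by rw [Circle.norm_coe, norm_one]; norm_num)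
  have h2 : ‖(n : ℂ) + 1‖ = n + 1 := by
    rw [show (n : ℂ) + 1 = ((n + 1 : ℕ) : ℂ) by push_cast; rfl, Complex.norm_natCast]
    push_cast; rfl
  rw [h2]
  gcongr

/-- The circles shrink to the origin. -/
theorem eventually_loop_mem {V : Set hawaiianEarring} (hV : V ∈ 𝓝 origin) :
    ∃ N, ∀ n ≥ N, ∀ w, loop n w ∈ V := by
  obtain ⟨ε, hε, hb⟩ := Metric.mem_nhds_iff.1 hV
  obtain ⟨N, hN⟩ := exists_nat_gt (2 / ε)
  refine ⟨N, fun n hn w => hb ?_⟩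
  rw [Metric.mem_ball, Subtype.dist_eq, dist_eq_norm]
  have : (origin : ℂ) = 0 := rfl
  rw [this, sub_zero]
  refine (norm_loop_le n w).trans_lt ?_
  rw [div_lt_iff₀ (by positivity)]
  rw [div_lt_iff₀ hε] at hN
  have : (N : ℝ) ≤ n := by exact_mod_cast hn
  nlinarith

/-- The bump on the line `2 * re = n + 1`, read after inversion: it is `1` on the circle of radius
`1 / (n + 1)` and `0` on the others. -/
noncomputable def bump (n : ℕ) (z : ℂ) : ℝ := max 0 (1 - |2 * (z⁻¹).re - (n + 1)|)

theorem bump_nonneg (n : ℕ) (z : ℂ) : 0 ≤ bump n z := le_max_left _ _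

theorem bump_le_one (n : ℕ) (z : ℂ) : bump n z ≤ 1 :=
  max_le zero_le_one (by linarith [abs_nonneg (2 * (z⁻¹).re - (n + 1))])

/-- `bump n` need not be continuous at `0`, but it is bounded, so the factor `z` repairs this. -/
theorem continuous_bump_mul (n : ℕ) : Continuous fun z : ℂ => (bump n z : ℂ) * z := by
  rw [continuous_iff_continuousAt]
  intro z
  by_cases hz : z = 0
  · subst hz
    rw [ContinuousAt, mul_zero, tendsto_zero_iff_norm_tendsto_zero]
    refine squeeze_zero (fun _ => norm_nonneg _) (fun w => ?_) (g := fun w : ℂ => ‖w‖) ?_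
    · rw [norm_mul, Complex.norm_real, Real.norm_of_nonneg (bump_nonneg n w)]
      exact mul_le_of_le_one_left (norm_nonneg _) (bump_le_one n w)
    · simpa using (continuous_norm (E := ℂ)).tendsto 0
  · have h1 : ContinuousAt (fun z : ℂ => z⁻¹) z := continuousAt_inv₀ hz
    have h2 : ContinuousAt (fun z : ℂ => bump n z) z := by
      unfold bump
      have := Complex.continuous_re.continuousAt.comp h1
      simp only [Function.comp_def] at this
      fun_prop
    have h3 : ContinuousAt (fun z : ℂ => (bump n z : ℂ)) z :=
      Complex.continuous_ofReal.continuousAt.comp h2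
    exact h3.mul continuousAt_id

theorem bump_loop_mul (n m : ℕ) (w : Circle) :
    (bump n (loop m w) : ℂ) * loop m w = if m = n then (loop m w : ℂ) else 0 := by
  by_cases h0 : (loop m w : ℂ) = 0
  · simp [h0]
  have h1 : 2 * ((loop m w : ℂ)⁻¹).re = m + 1 := by
    have h := loop_mem m w
    rw [← coe_loop] at h
    rw [Complex.inv_re]
    have : Complex.normSq (loop m w : ℂ) ≠ 0 := by simpa using h0
    field_simp
    linarith
  rw [bump, h1]
  split_ifs with h
  · subst h; simp
  · have : (1 : ℝ) ≤ |(m : ℝ) + 1 - (n + 1)| := by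
      have h2 : (1 : ℤ) ≤ |(m : ℤ) - n| := Int.one_le_abs (by omega)
      have h3 : (1 : ℝ) ≤ |(m : ℝ) - n| := by exact_mod_cast h2
      rwa [add_sub_add_right_eq_sub]
    rw [max_eq_left (by linarith)]
    simp

/-- The map that wraps the circle of radius `1 / (n + 1)` around the unit circle and is constant on
the other circles. -/
noncomputable def wrap (n : ℕ) : C(hawaiianEarring, Circle) where
  toFun z := ⟨1 - (n + 1) * ((bump n z : ℂ) * z), by
    obtain ⟨m, w, rfl⟩ := exists_loop_eq z
    rw [bump_loop_mul]
    have hm : (m : ℂ) + 1 ≠ 0 := by exact_mod_cast m.succ_ne_zero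
    split_ifs with h
    · subst h
      rw [coe_loop, mul_div_cancel₀ _ hm, sub_sub_cancel]
      exact w.2
    · simp⟩
  continuous_toFun := by
    have := (continuous_bump_mul n).comp (continuous_subtype_val (p := (· ∈ hawaiianEarring)))
    exact Continuous.subtype_mk (continuous_const.sub (continuous_const.mul this)) _

theorem coe_wrap (n : ℕ) (z : hawaiianEarring) :
    (wrap n z : ℂ) = 1 - (n + 1) * ((bump n z : ℂ) * z) := rfl

@[simp]
theorem wrap_loop (n : ℕ) (w : Circle) : wrap n (loop n w) = w := by
  have hn : (n : ℂ) + 1 ≠ 0 := by exact_mod_cast n.succ_ne_zero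
  refine Subtype.ext ?_
  rw [coe_wrap, bump_loop_mul, if_pos rfl, coe_loop, mul_div_cancel₀ _ hn]
  simp

theorem wrap_loop_of_ne {n m : ℕ} (h : m ≠ n) (w : Circle) : wrap n (loop m w) = 1 := by
  refine Subtype.ext ?_
  rw [coe_wrap, bump_loop_mul, if_neg h]
  simp

/-! ### The earring as a continuous image of the interval -/

/-- The path that runs through the circles one after the other, in reverse order. -/
noncomputable def trail (t : I) : ℂ :=
  (1 - Circle.exp (2 * Real.pi * (1 / t)) : ℂ) / (⌊1 / (t : ℝ)⌋ : ℂ)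

theorem one_le_floor {t : I} (ht : 0 < (t : ℝ)) : 1 ≤ ⌊1 / (t : ℝ)⌋ :=
  Int.le_floor.2 (by rw [Int.cast_one]; exact (one_le_div ht).2 t.2.2)

theorem trail_mem (t : I) : trail t ∈ hawaiianEarring := by
  rcases t.2.1.eq_or_lt with ht | ht
  -- With `1 / 0 = 0` the floor is `0`, and division by it sends `t = 0` to the origin.
  · rw [trail, ← ht]
    have h0 : (0 : ℂ) ∈ hawaiianEarring := origin.2
    simpa only [div_zero, Int.floor_zero, Int.cast_zero] using h0
  · obtain ⟨n, hn⟩ := Int.eq_ofNat_of_zero_le (zero_le_one.trans (one_le_floor ht))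
    obtain ⟨m, rfl⟩ : ∃ m, n = m + 1 := Nat.exists_eq_succ_of_ne_zero (by
      rintro rfl
      have := one_le_floor ht
      omega)
    convert! (loop m (Circle.exp (2 * Real.pi * (1 / t)))).2 using 1
    rw [trail, coe_loop, hn]
    push_cast
    rfl

theorem norm_trail_le (t : I) : ‖trail t‖ ≤ ‖(1 - Circle.exp (2 * Real.pi * (1 / t)) : ℂ)‖ := by
  rcases t.2.1.eq_or_lt with ht | ht
  · rw [trail, ← ht]
    simp
  · rw [trail, norm_div]
    refine div_le_self (norm_nonneg _) ?_
    rw [Complex.norm_intCast]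
    have h1 : (1 : ℝ) ≤ ⌊1 / (t : ℝ)⌋ := by exact_mod_cast one_le_floor ht
    exact h1.trans (le_abs_self _)

theorem norm_trail_le_mul (t : I) : ‖trail t‖ ≤ 4 * t := by
  rcases t.2.1.eq_or_lt with ht | ht
  · rw [trail, ← ht]
    simp
  · rw [trail, norm_div, Complex.norm_intCast]
    have h1 : (1 : ℝ) ≤ ⌊1 / (t : ℝ)⌋ := by exact_mod_cast one_le_floor ht
    have h2 : 1 / (t : ℝ) < ⌊1 / (t : ℝ)⌋ + 1 := Int.lt_floor_add_one _
    have h3 : ‖(1 - Circle.exp (2 * Real.pi * (1 / t)) : ℂ)‖ ≤ 2 :=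
      (norm_sub_le _ _).trans (by rw [Circle.norm_coe, norm_one]; norm_num)
    rw [abs_of_pos (by linarith), div_le_iff₀ (by linarith)]
    refine h3.trans ?_
    rw [div_lt_iff₀ ht] at h2
    nlinarith

theorem continuous_trail : Continuous trail := by
  rw [continuous_iff_continuousAt]
  intro t
  rcases t.2.1.eq_or_lt with ht | ht
  · have h0 : trail t = 0 := by
      rw [trail, ← ht]
      simp
    rw [ContinuousAt, h0, tendsto_zero_iff_norm_tendsto_zero]
    refine squeeze_zero (fun _ => norm_nonneg _) norm_trail_le_mul ?_
    have : Continuous fun s : I => 4 * (s : ℝ) := by fun_prop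
    simpa [← ht] using this.tendsto t
  · have hinv : ContinuousAt (fun s : I => 1 / (s : ℝ)) t :=
      continuousAt_const.div continuous_subtype_val.continuousAt ht.ne'
    have hnum : ContinuousAt
        (fun s : I => (1 - Circle.exp (2 * Real.pi * (1 / s)) : ℂ)) t := by
      have h1 : Continuous fun r : ℝ => (1 - Circle.exp (2 * Real.pi * r) : ℂ) := by fun_prop
      exact h1.continuousAt.comp (f := fun s : I => 1 / (s : ℝ)) hinv
    by_cases hm : ((⌊1 / (t : ℝ)⌋ : ℤ) : ℝ) = 1 / (t : ℝ)
    -- The floor jumps where `1/t` is an integer, but there the path is at the origin.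
    · have hz : (1 - Circle.exp (2 * Real.pi * (1 / t)) : ℂ) = 0 := by
        have : Circle.exp (2 * Real.pi * (1 / t)) = 1 := by
          rw [← hm, Circle.exp_eq_one]
          exact ⟨_, mul_comm _ _⟩
        rw [this]; simp
      have h0 : trail t = 0 := by rw [trail, hz, zero_div]
      rw [ContinuousAt, h0, tendsto_zero_iff_norm_tendsto_zero]
      refine squeeze_zero (fun _ => norm_nonneg _) norm_trail_le ?_
      have := hnum.norm.tendsto
      rwa [hz, norm_zero] at this
    · have hlt : ((⌊1 / (t : ℝ)⌋ : ℤ) : ℝ) < 1 / (t : ℝ) := lt_of_le_of_ne (Int.floor_le _) hm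
      have hev : ∀ᶠ s : I in 𝓝 t, ⌊1 / (s : ℝ)⌋ = ⌊1 / (t : ℝ)⌋ := by
        filter_upwards [hinv.eventually (Ioo_mem_nhds hlt (Int.lt_floor_add_one _))] with s hs
        exact Int.floor_eq_iff.2 ⟨hs.1.le, hs.2⟩
      have h1 : ContinuousAt (fun s : I => (1 - Circle.exp (2 * Real.pi * (1 / s)) : ℂ) /
          (⌊1 / (t : ℝ)⌋ : ℂ)) t := hnum.div_const _
      refine h1.congr ?_
      filter_upwards [hev] with s hs
      rw [trail, hs]

theorem exists_trail_eq (z : hawaiianEarring) : ∃ t, trail t = z := by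
  obtain ⟨n, w, rfl⟩ := exists_loop_eq z
  obtain ⟨θ, rfl⟩ : ∃ θ, Circle.exp θ = w := ⟨_, Circle.exp_arg w⟩
  have hf0 := Int.fract_nonneg (θ / (2 * Real.pi))
  have hf1 := Int.fract_lt_one (θ / (2 * Real.pi))
  have hn : (0 : ℝ) ≤ n := n.cast_nonneg
  -- The integer part of `s` selects the circle and its fractional part the angle.
  set s : ℝ := n + 1 + Int.fract (θ / (2 * Real.pi)) with hs
  have hs1 : 1 ≤ s := by linarith
  refine ⟨⟨1 / s, by positivity, (div_le_one (by positivity)).2 hs1⟩, ?_⟩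
  have hfl : ⌊s⌋ = (n : ℤ) + 1 := by
    rw [Int.floor_eq_iff]
    push_cast
    constructor <;> linarith
  have hexp : Circle.exp (2 * Real.pi * s) = Circle.exp θ := by
    refine Circle.exp_eq_exp.2 ⟨n + 1 - ⌊θ / (2 * Real.pi)⌋, ?_⟩
    have hpi : Real.pi ≠ 0 := Real.pi_ne_zero
    rw [hs, Int.fract]
    push_cast
    field_simp
    ring
  rw [trail, coe_loop]
  simp only [one_div_one_div, hfl, hexp]
  push_cast
  rfl

/-- The trail as a map onto the earring. -/
noncomputable def trailMap : C(I, hawaiianEarring) :=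
  ⟨fun t => ⟨trail t, trail_mem t⟩, continuous_trail.subtype_mk _⟩

theorem trailMap_surjective : Function.Surjective trailMap := fun z => by
  obtain ⟨t, ht⟩ := exists_trail_eq z
  exact ⟨t, Subtype.ext ht⟩

theorem pathConnectedSpace : PathConnectedSpace hawaiianEarring := by
  have hI : PathConnectedSpace I := isPathConnected_iff_pathConnectedSpace.1
    ((convex_Icc (0 : ℝ) 1).isPathConnected ⟨0, by simp⟩)
  exact trailMap_surjective.pathConnectedSpace trailMap.continuous

/-- The easy direction of Hahn–Mazurkiewicz: `trailMap` is a closed surjection, hence a quotient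
map, and local connectedness passes to quotients. -/
theorem isPeanoContinuum : IsPeanoContinuum hawaiianEarring := by
  have := pathConnectedSpace
  have hI : LocallyConnectedSpace I := (isQuotientMap_projIcc (h := zero_le_one (α := ℝ))).isCoinducing.locallyConnectedSpace
  refine ⟨⟨?_⟩, inferInstance, inferInstance, ?_⟩
  · rw [← trailMap_surjective.range_eq]
    exact isCompact_range trailMap.continuous
  · exact (trailMap.continuous.isClosedMap.isQuotientMap trailMap.continuous
      trailMap_surjective).isCoinducing.locallyConnectedSpace

/-! ### Maps from the earring to simply connected spaces and to the Alternating cone -/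

/-- In a simply connected space, one circle can be contracted while the others stay fixed. -/
theorem exists_homotopic_contract_loop {Z : Type*} [TopologicalSpace Z] [SimplyConnectedSpace Z]
    (f : C(hawaiianEarring, Z)) (n : ℕ) :
    ∃ f' : C(hawaiianEarring, Z), f.Homotopic f' ∧ (∀ w, f' (loop n w) = f origin) ∧
      ∀ m ≠ n, ∀ w, f' (loop m w) = f (loop m w) := by
  classical
  obtain ⟨G, hG0, hG1, hGt⟩ := exists_contraction_of_simplyConnectedSpace (f.comp (loop n))
  have hbase : (f.comp (loop n)) 1 = f origin := by simp
  rw [hbase] at hGt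
  simp only [hbase] at hG1
  let c : C(Z, C(I, Z)) := ContinuousMap.curry ContinuousMap.fst
  let K : hawaiianEarring → C(I, Z) := fun z => if wrap n z = 1 then c (f z) else G (wrap n z)
  have hKA : ∀ w, K (loop n w) = G w := by
    intro w
    simp only [K, wrap_loop]
    split_ifs with h
    · subst h
      ext t
      rw [hGt]
      simp [c]
    · rfl
  have hKB : ∀ z, wrap n z = 1 → K z = c (f z) := fun z hz => if_pos hz
  have hK : Continuous K := by
    -- `A` is the `n`-th circle and `B` the union of the others. They meet at the origin, where `G`
    -- is stationary, so the two homotopies can be pasted.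
    let A : Set hawaiianEarring := {z | loop n (wrap n z) = z}
    let B : Set hawaiianEarring := {z | wrap n z = 1}
    have hA : IsClosed A := isClosed_eq (by fun_prop) continuous_id
    have hB : IsClosed B := isClosed_eq (by fun_prop) continuous_const
    have hAB : A ∪ B = univ := by
      refine eq_univ_of_forall fun z => ?_
      obtain ⟨m, w, rfl⟩ := exists_loop_eq z
      by_cases h : m = n
      · subst h
        exact Or.inl (congrArg (loop m) (wrap_loop m w))
      · exact Or.inr (wrap_loop_of_ne h w)
    rw [← continuousOn_univ, ← hAB]
    refine ContinuousOn.union_of_isClosed ?_ ?_ hA hB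
    · have h1 : Continuous fun z => G (wrap n z) := by fun_prop
      refine h1.continuousOn.congr fun z (hz : loop n (wrap n z) = z) => ?_
      exact (hz ▸ hKA (wrap n z) :)
    · have h1 : Continuous fun z => c (f z) := by fun_prop
      exact h1.continuousOn.congr fun z hz => hKB z hz
  let F : C(I × hawaiianEarring, Z) :=
    (ContinuousMap.uncurry ⟨K, hK⟩).comp ContinuousMap.prodSwap
  have hF : ∀ t z, F (t, z) = K z t := fun _ _ => rfl
  let f' : C(hawaiianEarring, Z) := F.comp ((ContinuousMap.const _ 1).prodMk (.id _))
  have hf' : ∀ z, f' z = K z 1 := fun _ => rfl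
  refine ⟨f', ⟨⟨F, fun z => ?_, fun z => rfl⟩⟩, fun w => ?_, fun m hm w => ?_⟩
  · obtain ⟨m, w, rfl⟩ := exists_loop_eq z
    change K (loop m w) 0 = _
    by_cases h : m = n
    · subst h
      rw [hKA, hG0]; rfl
    · rw [hKB _ (wrap_loop_of_ne h w)]; rfl
  · rw [hf', hKA, hG1]
  · rw [hf', hKB _ (wrap_loop_of_ne hm w)]; rfl

theorem exists_homotopic_contract_loops {Z : Type*} [TopologicalSpace Z] [SimplyConnectedSpace Z]
    (f : C(hawaiianEarring, Z)) (N : ℕ) :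
    ∃ f' : C(hawaiianEarring, Z), f.Homotopic f' ∧ (∀ n < N, ∀ w, f' (loop n w) = f origin) ∧
      ∀ n ≥ N, ∀ w, f' (loop n w) = f (loop n w) := by
  induction N with
  | zero => exact ⟨f, .refl _, fun n hn => absurd hn n.not_lt_zero, fun _ _ _ => rfl⟩
  | succ N ih =>
    obtain ⟨g, hg, hg1, hg2⟩ := ih
    obtain ⟨h, hh, hh1, hh2⟩ := exists_homotopic_contract_loop g N
    have horig : g origin = f origin := by
      have := hg2 N le_rfl 1
      rwa [loop_one] at this
    refine ⟨h, hg.trans hh, fun n hn w => ?_, fun n hn w => ?_⟩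
    · rcases (Nat.lt_succ_iff.1 hn).eq_or_lt with rfl | hlt
      · rw [hh1, horig]
      · rw [hh2 n hlt.ne, hg1 n hlt]
    · rw [hh2 n (by omega), hg2 n (by omega)]

theorem nullhomotopic_alternatingCone {X : Type*} [TopologicalSpace X] [PathConnectedSpace X]
    (x : X) (f : C(hawaiianEarring, AlternatingCone X x)) : f.Nullhomotopic := by
  have hsc := AlternatingCone.simplyConnectedSpace (x := x)
  have key : ∀ V : Set (AlternatingCone X x), V ∈ 𝓝 (f origin) →
      ∃ f' : C(hawaiianEarring, AlternatingCone X x), f.Homotopic f' ∧ ∀ z, f' z ∈ V := by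
    intro V hV
    obtain ⟨N, hN⟩ := eventually_loop_mem (f.continuous.continuousAt hV)
    obtain ⟨f', hf', h1, h2⟩ := exists_homotopic_contract_loops f N
    refine ⟨f', hf', fun z => ?_⟩
    obtain ⟨n, w, rfl⟩ := exists_loop_eq z
    rcases lt_or_ge n N with hn | hn
    · rw [h1 n hn]; exact mem_of_mem_nhds hV
    · rw [h2 n hn]; exact hN n hn w
  have hh : Continuous fun z => (AlternatingCone.height x z : ℝ) := by fun_prop
  rcases lt_or_ge (AlternatingCone.height x (f origin) : ℝ) (3 / 4) with h | h
  · obtain ⟨f', hf', hV⟩ := key {z | (AlternatingCone.height x z : ℝ) < 3 / 4}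
      ((isOpen_lt hh continuous_const).mem_nhds h)
    obtain ⟨y, hy⟩ := AlternatingCone.nullhomotopic_of_height_le f' fun z => le_of_lt (hV z)
    exact ⟨y, hf'.trans hy⟩
  · obtain ⟨f', hf', hV⟩ := key {z | 1 / 4 < (AlternatingCone.height x z : ℝ)}
      ((isOpen_lt continuous_const hh).mem_nhds (show (1 / 4 : ℝ) < _ by linarith))
    obtain ⟨y, hy⟩ := AlternatingCone.nullhomotopic_of_le_height f' fun z => le_of_lt (hV z)
    exact ⟨y, hf'.trans hy⟩

end HawaiianEarring

/-! ### Oscillation of the sine curve -/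

theorem fst_eq_zero_of_mem_limitSegment {p : ℝ × ℝ} (hp : p ∈ limitSegment) : p.1 = 0 := by
  obtain ⟨a, b, -, -, -, rfl⟩ := hp
  simp

/-- Strictly between two consecutive vertical segments, the sine curve is the graph of a linear
function. -/
theorem snd_eq_of_mem_sineCurve {p : ℝ × ℝ} (hp : p ∈ sineCurve) {n : ℕ}
    (h1 : 1 / ((n : ℝ) + 2) < p.1) (h2 : p.1 < 1 / ((n : ℝ) + 1)) :
    p.2 = (n + 1) * ((n + 2) * p.1 - 1) := by
  have hn : (0 : ℝ) ≤ n := n.cast_nonneg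
  rw [div_lt_iff₀ (by positivity)] at h1
  rw [lt_div_iff₀ (by positivity)] at h2
  rcases hp with hp | hp
  · rw [fst_eq_zero_of_mem_limitSegment hp] at h1
    linarith
  · obtain ⟨m, ⟨a, b, ha, hb, hab, rfl⟩ | ⟨a, b, ha, hb, hab, rfl⟩⟩ := mem_iUnion.1 hp
    · have hm : (0 : ℝ) ≤ m := m.cast_nonneg
      exfalso
      simp only [Prod.smul_mk, Prod.mk_add_mk, smul_eq_mul, ← add_mul, hab, one_mul] at h1 h2
      rw [one_div, inv_mul_eq_div, lt_div_iff₀ (by positivity)] at h1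
      rw [one_div, inv_mul_eq_div, div_lt_iff₀ (by positivity)] at h2
      have h3 : m < n + 1 := by have : (m : ℝ) < n + 1 := by linarith
                                exact_mod_cast this
      have h4 : n < m := by have : (n : ℝ) < m := by linarith
                            exact_mod_cast this
      omega
    · have hm : (0 : ℝ) ≤ m := m.cast_nonneg
      obtain rfl : a = 1 - b := by linarith
      simp only [Prod.smul_mk, Prod.mk_add_mk, smul_eq_mul] at h1 h2 ⊢
      have hp1 : (1 - b) * (1 / ((m : ℝ) + 1)) + b * (1 / ((m : ℝ) + 2)) =
          (m + 2 - b) / ((m + 1) * (m + 2)) := by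
        field_simp
        ring
      rw [hp1] at h1 h2 ⊢
      have hpos : (0 : ℝ) < (m + 1) * (m + 2) := by positivity
      rw [div_mul_eq_mul_div, lt_div_iff₀ hpos] at h1
      rw [div_mul_eq_mul_div, div_lt_iff₀ hpos] at h2
      obtain rfl : m = n := by
        have h3 : (m : ℝ) < n + 1 := by
          by_contra! h
          nlinarith
        have h4 : (n : ℝ) < m + 1 := by
          by_contra! h
          nlinarith
        have h3' : m < n + 1 := by exact_mod_cast h3
        have h4' : n < m + 1 := by exact_mod_cast h4
        omega
      field_simp
      ring

/-- A path that follows the sine curve cannot converge on the limit segment. -/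
theorem sineCurve_oscillation {u v : ℝ → ℝ} (hu : Continuous u) (hv : Continuous v) {a b : ℝ}
    (hab : a < b) (hub : u b ≤ 0) (hpos : ∀ t ∈ Ico a b, 0 < u t)
    (h : ∀ t ∈ Ico a b, ∀ n : ℕ, 1 / ((n : ℝ) + 2) < u t → u t < 1 / ((n : ℝ) + 1) →
      v t = (n + 1) * ((n + 2) * u t - 1)) : False := by
  obtain ⟨δ, hδ, hvδ⟩ := Metric.continuous_iff.1 hv b (1 / 4) (by norm_num)
  obtain ⟨c, hc, hcb⟩ : ∃ c, max a (b - δ) < c ∧ c < b :=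
    exists_between (max_lt hab (by linarith))
  have hac : a < c := (le_max_left _ _).trans_lt hc
  have hδc : b - δ < c := (le_max_right _ _).trans_lt hc
  obtain ⟨n, hn⟩ := exists_nat_one_div_lt (hpos c ⟨hac.le, hcb⟩)
  have hn0 : (0 : ℝ) ≤ n := n.cast_nonneg
  -- On the way to `u b ≤ 0` the path crosses a whole slanted segment, so near `b` the function `v`
  -- takes every value `r` in `(0, 1)`. The abscissa used solves `r = (n + 1) * ((n + 2) * u - 1)`.
  -- The values `1/8` and `7/8` cannot both be within `1/4` of `v b`.
  have key : ∀ r : ℝ, 0 < r → r < 1 → |r - v b| < 1 / 4 := by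
    intro r hr0 hr1
    have hy1 : 1 / ((n : ℝ) + 2) < (1 + r / (n + 1)) / (n + 2) := by
      gcongr
      have : 0 < r / (n + 1) := by positivity
      linarith
    have hy2 : (1 + r / (n + 1)) / (n + 2) < 1 / ((n : ℝ) + 1) := by
      rw [div_lt_div_iff₀ (by positivity) (by positivity)]
      have : r / (n + 1) * (n + 1) = r := by field_simp
      nlinarith
    have hy0 : 0 < (1 + r / (n + 1)) / ((n : ℝ) + 2) := by positivity
    obtain ⟨t, ht, hut⟩ := intermediate_value_Icc' hcb.le hu.continuousOn
      ⟨hub.trans hy0.le, (hy2.trans hn).le⟩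
    have htb : t < b := lt_of_le_of_ne ht.2 (by rintro rfl; linarith)
    have hvt := h t ⟨hac.le.trans ht.1, htb⟩ n (by rwa [hut]) (by rwa [hut])
    have hvr : v t = r := by
      rw [hvt, hut]
      field_simp
      ring
    have := hvδ t (by rw [Real.dist_eq, abs_lt]; constructor <;> linarith [ht.1])
    rwa [Real.dist_eq, hvr] at this
  have h1 := abs_lt.1 (key (1 / 8) (by norm_num) (by norm_num))
  have h2 := abs_lt.1 (key (7 / 8) (by norm_num) (by norm_num))
  linarith [h1.1, h1.2, h2.1, h2.2]

/-! ### The natural map to the Snake cone is essential -/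

namespace SnakeCone

open Topology unitInterval HawaiianEarring

/-- The projection of the Snake cone to the plane. -/
def proj {X : Type*} [TopologicalSpace X] (x : X) : C(SnakeCone X x, ℝ × ℝ) where
  toFun := Quot.lift (Sum.elim (fun p => (p.1 : ℝ × ℝ)) fun s => (s : ℝ × ℝ)) (by
    rintro _ _ (⟨t, s, h, -⟩ | ⟨t, y, s, h, -⟩) <;> exact h)
  continuous_toFun := continuous_quot_lift _ (continuous_sumElim.2
    ⟨by fun_prop, by fun_prop⟩)

/-- The displacement from the base point, scaled so as to vanish on the limit segment. -/
noncomputable def displacement (x : hawaiianEarring) : C(SnakeCone hawaiianEarring x, ℂ) where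
  toFun := Quot.lift
    (Sum.elim (fun p => ((p.1 : ℝ × ℝ).1 : ℂ) * ((p.2 : ℂ) - x)) fun _ => 0) (by
      rintro _ _ (⟨t, s, -, -⟩ | ⟨t, y, s, -, h⟩)
      · simp
      · simp [fst_eq_zero_of_mem_limitSegment h])
  continuous_toFun := continuous_quot_lift _ (continuous_sumElim.2
    ⟨by fun_prop, continuous_const⟩)

/-- The retraction to the earring of the part of the Snake cone off the limit segment. -/
noncomputable def retraction (x : hawaiianEarring) (z : SnakeCone hawaiianEarring x) : ℂ :=
  x + displacement x z / ((proj x z).1 : ℂ)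

variable {x : hawaiianEarring}

theorem displacement_toSnakeCone (h : hawaiianEarring) :
    displacement x (toSnakeCone x h) = h - x := by
  change (((1 : ℝ) : ℂ)) * ((h : ℂ) - x) = _
  simp

theorem retraction_toSnakeCone (h : hawaiianEarring) : retraction x (toSnakeCone x h) = h := by
  rw [retraction, displacement_toSnakeCone]
  have : (proj x (toSnakeCone x h)).1 = 1 := rfl
  simp [this]

theorem isEmbedding_toSnakeCone (x : hawaiianEarring) : IsEmbedding (toSnakeCone x) := by
  refine IsEmbedding.of_comp (toSnakeCone x).continuous (displacement x).continuous ?_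
  have : displacement x ∘ toSnakeCone x = (Homeomorph.subRight (x : ℂ)) ∘ Subtype.val := by
    funext h
    simpa using displacement_toSnakeCone h
  rw [this]
  exact (Homeomorph.subRight (x : ℂ)).isEmbedding.comp IsEmbedding.subtypeVal

theorem retraction_mem {z : SnakeCone hawaiianEarring x} (hz : 0 < (proj x z).1) :
    retraction x z ∈ hawaiianEarring := by
  obtain ⟨⟨t, h⟩ | s, rfl⟩ := Quot.exists_rep z
  · have ht : (((t : ℝ × ℝ).1 : ℝ) : ℂ) ≠ 0 := by exact_mod_cast hz.ne'
    change (x : ℂ) + ((t : ℝ × ℝ).1 : ℂ) * ((h : ℂ) - x) / ((t : ℝ × ℝ).1 : ℂ) ∈ hawaiianEarring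
    rw [mul_div_cancel_left₀ _ ht, add_sub_cancel]
    exact h.2
  · change (x : ℂ) + 0 / _ ∈ hawaiianEarring
    rw [zero_div, add_zero]
    exact x.2

/-- Over such points the cone consists of the square alone, where the displacement is zero. -/
theorem retraction_eq_of_notMem {z : SnakeCone hawaiianEarring x} (hz : proj x z ∉ sineCurve) :
    retraction x z = x := by
  obtain ⟨⟨t, h⟩ | s, rfl⟩ := Quot.exists_rep z
  · exact absurd t.2 hz
  · change (x : ℂ) + 0 / _ = x
    rw [zero_div, add_zero]

theorem continuousOn_retraction : ContinuousOn (retraction x) {z | 0 < (proj x z).1} := by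
  refine continuousOn_const.add ((displacement x).continuous.continuousOn.div ?_ fun z hz => ?_)
  · exact Continuous.continuousOn (by fun_prop)
  · exact_mod_cast (show (0 : ℝ) < _ from hz).ne'

/-- As long as the trace of the origin avoids the limit segment, a homotopy of the natural map
keeps the small circles essential. -/
theorem exists_forall_retraction_not_const {y : SnakeCone hawaiianEarring x}
    (F : (toSnakeCone x).Homotopy (.const _ y)) {s : I}
    (hs : ∀ t ≤ s, 0 < (proj x (F (t, origin))).1) :
    ∃ N, ∀ n ≥ N, ¬ ∃ a, ∀ w, retraction x (F (s, loop n w)) = a := by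
  have hopen : IsOpen {p : I × hawaiianEarring | 0 < (proj x (F p)).1} :=
    isOpen_lt continuous_const (by fun_prop)
  -- By the tube lemma the small circles have positive abscissa at all times up to `s`, so
  -- retracting and wrapping gives a homotopy from the identity of the circle.
  obtain ⟨U, V, -, hVo, hU, hV, hUV⟩ := generalized_tube_lemma (s := Iic s) isClosed_Iic.isCompact
    (t := {origin}) isCompact_singleton hopen (by
      rintro ⟨t, h⟩ ⟨ht, hh⟩
      obtain rfl : h = origin := hh
      exact hs t ht)
  obtain ⟨N, hN⟩ := eventually_loop_mem (hVo.mem_nhds (hV rfl))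
  refine ⟨N, fun n hn ⟨a, ha⟩ => Circle.not_nullhomotopic_id ?_⟩
  have hpos : ∀ p : I × Circle, 0 < (proj x (F (p.1 * s, loop n p.2))).1 := fun p =>
    hUV ⟨hU (show p.1 * s ≤ s from mul_le_of_le_one_left s.2.1 p.1.2.2), hN n hn p.2⟩
  let K : C(I × Circle, Circle) :=
    ⟨fun p => wrap n ⟨retraction x (F (p.1 * s, loop n p.2)), retraction_mem (hpos p)⟩, by
      refine (wrap n).continuous.comp (Continuous.subtype_mk ?_ _)
      exact continuousOn_retraction.comp_continuous (by fun_prop) hpos⟩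
  refine ⟨K (1, 1), ⟨⟨K, fun w => ?_, fun w => ?_⟩⟩⟩
  · have h0 : retraction x (F ((0 : I) * s, loop n w)) = loop n w := by
      rw [zero_mul, F.apply_zero, retraction_toSnakeCone]
    change wrap n ⟨retraction x (F ((0 : I) * s, loop n w)), _⟩ = w
    simp only [h0]
    exact wrap_loop n w
  · have h1 : ∀ w, retraction x (F ((1 : I) * s, loop n w)) = a := fun w => by
      rw [one_mul, ha]
    change wrap n ⟨retraction x (F ((1 : I) * s, loop n w)), _⟩ =
      wrap n ⟨retraction x (F ((1 : I) * s, loop n 1)), _⟩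
    simp only [h1]

theorem not_nullhomotopic_toSnakeCone (x : hawaiianEarring) : ¬ (toSnakeCone x).Nullhomotopic := by
  rintro ⟨y, ⟨F⟩⟩
  let c : ℝ → SnakeCone hawaiianEarring x := fun t => F (projIcc 0 1 zero_le_one t, origin)
  have hc : Continuous c := by
    have := continuous_projIcc (h := zero_le_one (α := ℝ))
    fun_prop
  have hcI : ∀ t : I, c t = F (t, origin) := fun t => by
    change F (projIcc 0 1 zero_le_one (t : ℝ), origin) = _
    rw [projIcc_val]
  have hu : Continuous fun t => (proj x (c t)).1 := by fun_prop
  have hv : Continuous fun t => (proj x (c t)).2 := by fun_prop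
  have hhit : (Icc (0 : ℝ) 1 ∩ {t | (proj x (c t)).1 ≤ 0}).Nonempty := by
    by_contra hne
    rw [not_nonempty_iff_eq_empty, eq_empty_iff_forall_notMem] at hne
    obtain ⟨N, hN⟩ := exists_forall_retraction_not_const F (s := 1) fun t _ => by
      have h := hne t
      rw [← hcI]
      exact not_le.1 fun h' => h ⟨t.2, h'⟩
    exact hN N le_rfl ⟨retraction x y, fun w => by simp⟩
  -- `b` is the first time at which the trace of the origin reaches abscissa `≤ 0`.
  obtain ⟨b, ⟨hbI, hb⟩, hmin⟩ :=
    (isCompact_Icc.inter_right (isClosed_le hu continuous_const)).exists_isLeast hhit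
  have hpos : ∀ t ∈ Ico 0 b, 0 < (proj x (c t)).1 := fun t ht => not_le.1 fun h =>
    ht.2.not_ge (hmin ⟨⟨ht.1, ht.2.le.trans hbI.2⟩, h⟩)
  have hb0 : 0 < b := by
    refine lt_of_le_of_ne hbI.1 fun h => ?_
    have h1 : c b = toSnakeCone x origin := by
      rw [← h]
      exact (hcI 0).trans (F.apply_zero _)
    have h2 : (proj x (toSnakeCone x origin)).1 = 1 := rfl
    have h3 : (proj x (c b)).1 ≤ 0 := hb
    rw [h1, h2] at h3
    linarith
  refine sineCurve_oscillation hu hv hb0 hb hpos fun t ht n h1 h2 => ?_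
  -- If the trace is off the slanted segment at time `t`, so are the images of all small circles by
  -- openness; they miss the sine curve and retract to `x`, although they should be essential.
  by_contra hne
  let s : I := ⟨t, ht.1, ht.2.le.trans hbI.2⟩
  have hst : c t = F (s, origin) := hcI s
  obtain ⟨N, hN⟩ := exists_forall_retraction_not_const F (s := s) fun r hr => by
    rw [← hcI]
    exact hpos r ⟨r.2.1, lt_of_le_of_lt hr ht.2⟩
  let p : hawaiianEarring → ℝ × ℝ := fun h => proj x (F (s, h))
  have hp : Continuous p := by fun_prop
  have h1o : IsOpen {h | 1 / ((n : ℝ) + 2) < (p h).1} := isOpen_lt (by fun_prop) (by fun_prop)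
  have h2o : IsOpen {h | (p h).1 < 1 / ((n : ℝ) + 1)} := isOpen_lt (by fun_prop) (by fun_prop)
  have h3o : IsOpen {h | (p h).2 ≠ (n + 1) * ((n + 2) * (p h).1 - 1)} :=
    isOpen_ne_fun (by fun_prop) (by fun_prop)
  rw [hst] at h1 h2 hne
  obtain ⟨M, hM⟩ := eventually_loop_mem (((h1o.inter h2o).inter h3o).mem_nhds ⟨⟨h1, h2⟩, hne⟩)
  refine hN (max N M) (le_max_left _ _) ⟨x, fun w => retraction_eq_of_notMem fun hmem => ?_⟩
  obtain ⟨⟨h3, h4⟩, h5⟩ := hM _ (le_max_right N M) w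
  exact h5 (snd_eq_of_mem_sineCurve hmem h3 h4)

end SnakeCone

/-! ### Conclusion -/

theorem theorem5 :
    IsPeanoContinuum hawaiianEarring ∧
    (∀ x y : hawaiianEarring,
      ¬ Nonempty (ContinuousMap.HomotopyEquiv
          (AlternatingCone hawaiianEarring x) (SnakeCone hawaiianEarring y))) ∧
    (∀ x : hawaiianEarring,
      Topology.IsEmbedding (toSnakeCone x) ∧ ¬ (toSnakeCone x).Nullhomotopic) ∧
    (∀ (x : hawaiianEarring) (ψ : C(hawaiianEarring, AlternatingCone hawaiianEarring x)),
      ψ.Nullhomotopic) := by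
  have hpc := HawaiianEarring.pathConnectedSpace
  refine ⟨HawaiianEarring.isPeanoContinuum, fun x y ⟨e⟩ => ?_, fun x =>
    ⟨SnakeCone.isEmbedding_toSnakeCone x, SnakeCone.not_nullhomotopic_toSnakeCone x⟩,
    fun x ψ => HawaiianEarring.nullhomotopic_alternatingCone x ψ⟩
  obtain ⟨z, hz⟩ := (HawaiianEarring.nullhomotopic_alternatingCone x
    (e.invFun.comp (toSnakeCone y))).comp_right e.toFun
  exact SnakeCone.not_nullhomotopic_toSnakeCone y
    ⟨z, (ContinuousMap.Homotopic.comp e.right_inv (.refl (toSnakeCone y))).symm.trans hz⟩
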